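/- Let $n\ge 0$ be an integer and let $\omega=(\omega_1,\dots,\omega_n)\in\mathbb R^n$ be nonresonant, i.e. $\langle q,\omega\rangle\ne 0$ for all $q\in\mathbb Z^n\setminus\{0\}$. Let $\mathcal F=\mathbb C[[z_1,\dots,z_n,\bar z_1,\dots,\bar z_n]]$ be the ring of formal power series $H=\sum_{k,\bar k\in\mathbb Z_{\ge0}^n}H_{k,\bar k}\,z^k\bar z^{\bar k}$ in $2n$ independent variables, and let $\mathcal F_\diamond\subset\mathcal F$ be the subspace of series all of whose terms have total degree at least $3$. For $r>0$ put $D_r=\{(z,\bar z)\in\mathbb C^{2n}:|z_j|<r,\ |\bar z_j|<r,\ 1\le j\le n\}$, and let $\mathcal A^r\subset\mathcal F$ be the space of series that converge on $D_r$ to a function with $\sup_{D_r}|H|<\infty$. Let $$\{F,G\}=i\sum_{j=1}^n\big(\partial_{\bar z_j}F\,\partial_{z_j}G-\partial_{z_j}F\,\partial_{\bar z_j}G\big),\qquad H_2=\sum_{j=1}^n\omega_jz_j\bar z_j,\qquad \xi H=-i\sum_{k,\bar k}\operatorname{sign}\big(\langle\omega,\bar k-k\rangle\big)\,H_{k,\bar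 k}\,z^k\bar z^{\bar k}.$$ Let $\rho>0$ and $\widehat H_\diamond\in\mathcal A^\rho\cap\mathcal F_\diamond$. Then the initial value problem $$\partial_\delta H_\diamond=-\{\xi H_\diamond,\,H_2+H_\diamond\},\qquad H_\diamond|_{\delta=0}=\widehat H_\diamond,$$ understood coefficient by coefficient, has a unique solution $\delta\mapsto\phi^\delta(\widehat H_\diamond)\in\mathcal F_\diamond$ on $[0,\infty)$, and there are constants $A,B>0$ and a function $g:[0,\infty)\to\mathbb R$ such that for every $\delta\ge 0$ $$\phi^\delta(\widehat H_\diamond)\in\mathcal A^{g(\delta)}\cap\mathcal F_\diamond,\qquad g(\delta)\ge\frac{A}{1+B\delta}.$$ -/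

import Mathlib

open scoped BigOperators

noncomputable section

namespace NormalizationFlow

/-- The ring `ℂ[[z₁,…,zₙ,z̄₁,…,z̄ₙ]]` of formal power series in `2n` independent variables:
the index `Sum.inl j` stands for `z_j`, the index `Sum.inr j` for `z̄_j`. -/
abbrev Series (n : ℕ) : Type := MvPowerSeries (Fin n ⊕ Fin n) ℂ

/-- Multi-indices `𝐤 = (k, k̄)`. -/
abbrev Index (n : ℕ) : Type := (Fin n ⊕ Fin n) →₀ ℕ

/-- The frequency vector is nonresonant: no nontrivial integer combination vanishes. -/
def Nonresonant {n : ℕ} (ω : Fin n → ℝ) : Prop :=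
  ∀ q : Fin n → ℤ, q ≠ 0 → ∑ j, (q j : ℝ) * ω j ≠ 0

/-- Formal power series all of whose terms have total degree at least `3`. -/
def diamondSpace (n : ℕ) : Set (Series n) :=
  {H | ∀ k : Index n, k.degree < 3 → MvPowerSeries.coeff k H = 0}

/-- The open polydisk `|z_j| < ρ`, `|z̄_j| < ρ` in `ℂ²ⁿ`. -/
def polydisk (n : ℕ) (ρ : ℝ) : Set (Fin n ⊕ Fin n → ℂ) :=
  {z | ∀ i, ‖z i‖ < ρ}

/-- The term `H_𝐤 𝐳^𝐤` of the series `H` at the point `𝐳`. -/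
def term {n : ℕ} (H : Series n) (z : Fin n ⊕ Fin n → ℂ) (k : Index n) : ℂ :=
  MvPowerSeries.coeff k H * ∏ i, z i ^ k i

/-- The space of power series that converge on the polydisk of radius `ρ` to a function
with finite supremum norm there. -/
def analyticSpace (n : ℕ) (ρ : ℝ) : Set (Series n) :=
  {H | (∀ z ∈ polydisk n ρ, Summable (term H z)) ∧
    ∃ C : ℝ, ∀ z ∈ polydisk n ρ, ‖∑' k, term H z k‖ ≤ C}

/-- The Poisson bracket `{F,G} = i ∑_j (∂_{z̄_j}F ∂_{z_j}G - ∂_{z_j}F ∂_{z̄_j}G)`. -/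
def poissonBracket {n : ℕ} (F G : Series n) : Series n :=
  Complex.I • ∑ j : Fin n,
    (MvPowerSeries.pderiv ℂ (Sum.inr j) F * MvPowerSeries.pderiv ℂ (Sum.inl j) G -
      MvPowerSeries.pderiv ℂ (Sum.inl j) F * MvPowerSeries.pderiv ℂ (Sum.inr j) G)

/-- The quadratic Hamiltonian `H₂ = ∑_j ω_j z_j z̄_j`. -/
def quadraticPart {n : ℕ} (ω : Fin n → ℝ) : Series n :=
  ∑ j : Fin n, (ω j : ℂ) • (MvPowerSeries.X (Sum.inl j) * MvPowerSeries.X (Sum.inr j))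

/-- `⟨ω, 𝐤'⟩`, where `𝐤' = k̄ - k`. -/
def frequency {n : ℕ} (ω : Fin n → ℝ) (k : Index n) : ℝ :=
  ∑ j : Fin n, ω j * ((k (Sum.inr j) : ℝ) - (k (Sum.inl j) : ℝ))

/-- The operator `ξ`, acting on coefficients by `H_𝐤 ↦ -i sign(⟨ω, 𝐤'⟩) H_𝐤`. -/
def xi {n : ℕ} (ω : Fin n → ℝ) (H : Series n) : Series n :=
  fun k => -Complex.I * (Real.sign (frequency ω k) : ℂ) * MvPowerSeries.coeff k H

/-- `γ` is a curve in the space of series of order at least `3`, defined on the set `I` of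
parameters, that solves `∂_δ H = -{ξ H, H₂ + H}` coefficientwise with `H = Hhat` at `δ = 0`. -/
structure IsSolution {n : ℕ} (ω : Fin n → ℝ) (Hhat : Series n) (I : Set ℝ)
    (γ : ℝ → Series n) : Prop where
  mem_diamondSpace : ∀ δ ∈ I, γ δ ∈ diamondSpace n
  initial : γ 0 = Hhat
  hasDeriv : ∀ δ ∈ I, ∀ k : Index n,
    HasDerivWithinAt (fun s => MvPowerSeries.coeff k (γ s))
      (MvPowerSeries.coeff k (-poissonBracket (xi ω (γ δ)) (quadraticPart ω + γ δ))) I δ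

/-- The initial value problem has a solution on `[0, ∞)`, and only one. -/
def FlowDefined {n : ℕ} (ω : Fin n → ℝ) (Hhat : Series n) : Prop :=
  ∃ γ : ℝ → Series n, IsSolution ω Hhat (Set.Ici 0) γ ∧
    ∀ γ' : ℝ → Series n, IsSolution ω Hhat (Set.Ici 0) γ' → Set.EqOn γ' γ (Set.Ici 0)

open scoped Classical in
/-- The normalization flow `φ^δ(Hhat)`: the value at `δ ≥ 0` of the unique solution
(with value `0` by convention if the initial value problem is not uniquely solvable). -/
def flow {n : ℕ} (ω : Fin n → ℝ) (δ : ℝ) (Hhat : Series n) : Series n :=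
  if h : FlowDefined ω Hhat then h.choose δ else 0

end NormalizationFlow

end

/-
Since `{F, H₂}` multiplies the coefficient of index `𝐤` by `i⟨ω, 𝐤'⟩`, the flow reads, coefficient
by coefficient, `∂_δ H_𝐤 = -|⟨ω, 𝐤'⟩| H_𝐤 - {ξH, H}_𝐤`: a damped linear equation whose inhomogeneity
involves only coefficients of lower degree, because `H` has order at least `3`. So the system is
triangular and its integral form can be solved and is unique by recursion on the degree.

For the radius of convergence, drop the damping. The `ℓ¹` norms `h_m` of the homogeneous components
then satisfy the quadratic integral inequalities
`h_m(δ) ≤ h_m(0) + ∫₀^δ ∑_{p + q = m + 2} p h_p q h_q`, for which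
`C R^m m⁻³ (1 + 16 C R² δ)^(m - 3)` is a supersolution. The geometric rate `R (1 + 16 C R² δ)` of
this majorant grows linearly in `δ`.
-/

noncomputable section

namespace NormalizationFlow

open Finset
open MvPowerSeries (coeff pderiv)
open scoped MvPowerSeries.WithPiTopology

section HomNorm

variable {σ R : Type*} [Fintype σ] [DecidableEq σ]

theorem mem_finsuppAntidiag_univ {m : ℕ} {k : σ →₀ ℕ} :
    k ∈ finsuppAntidiag univ m ↔ k.degree = m := by
  simp [Finsupp.degree_eq_sum]

/-- The `ℓ¹` norm of the homogeneous component of degree `m` of a power series. -/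
def homNorm [SeminormedRing R] (m : ℕ) (F : MvPowerSeries σ R) : ℝ :=
  ∑ k ∈ finsuppAntidiag univ m, ‖coeff k F‖

section Ring

variable [SeminormedRing R] {F G : MvPowerSeries σ R}

theorem homNorm_nonneg (m : ℕ) (F : MvPowerSeries σ R) : 0 ≤ homNorm m F :=
  sum_nonneg fun _ _ => norm_nonneg _

theorem homNorm_mono (h : ∀ k, ‖coeff k F‖ ≤ ‖coeff k G‖) (m : ℕ) : homNorm m F ≤ homNorm m G :=
  sum_le_sum fun k _ => h k

theorem homNorm_eq_zero_of_lt_order {m : ℕ} (h : m < F.order) : homNorm m F = 0 :=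
  sum_eq_zero fun k hk => by
    rw [MvPowerSeries.coeff_of_lt_order (by rwa [mem_finsuppAntidiag_univ.1 hk]), norm_zero]

theorem continuous_homNorm (m : ℕ) : Continuous (homNorm m : MvPowerSeries σ R → ℝ) :=
  continuous_finsetSum _ fun k _ => (MvPowerSeries.WithPiTopology.continuous_coeff R k).norm

theorem homNorm_mul_pow (F : MvPowerSeries σ R) (m : ℕ) (r : ℝ) :
    homNorm m F * r ^ m = ∑ k ∈ finsuppAntidiag univ m, ‖coeff k F‖ * r ^ k.degree := by
  rw [homNorm, sum_mul]
  exact sum_congr rfl fun k hk => by rw [mem_finsuppAntidiag_univ.1 hk]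

theorem summable_norm_coeff_mul_pow {r : ℝ} (hr : 0 ≤ r)
    (h : Summable fun m => homNorm m F * r ^ m) :
    Summable fun k => ‖coeff k F‖ * r ^ k.degree := by
  refine summable_of_sum_le (c := ∑' m, homNorm m F * r ^ m) (fun k => by positivity) fun s => ?_
  calc ∑ k ∈ s, ‖coeff k F‖ * r ^ k.degree
      = ∑ m ∈ s.image Finsupp.degree, ∑ k ∈ s with k.degree = m, ‖coeff k F‖ * r ^ k.degree :=
        (sum_fiberwise_of_maps_to (fun _ => mem_image_of_mem _) _).symm
    _ ≤ ∑ m ∈ s.image Finsupp.degree, homNorm m F * r ^ m := by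
        refine sum_le_sum fun m _ => ?_
        rw [homNorm_mul_pow]
        exact sum_le_sum_of_subset_of_nonneg
          (fun k hk => mem_finsuppAntidiag_univ.2 (mem_filter.1 hk).2) fun k _ _ => by positivity
    _ ≤ ∑' m, homNorm m F * r ^ m :=
        h.sum_le_tsum _ fun m _ => mul_nonneg (homNorm_nonneg m F) (pow_nonneg hr m)

theorem sum_finsuppAntidiag_sum_antidiagonal {M : Type*} [AddCommMonoid M] (m : ℕ)
    (f : (σ →₀ ℕ) × (σ →₀ ℕ) → M) :
    ∑ k ∈ finsuppAntidiag univ m, ∑ a ∈ antidiagonal k, f a =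
      ∑ p ∈ antidiagonal m, ∑ a ∈ finsuppAntidiag univ p.1 ×ˢ finsuppAntidiag univ p.2, f a := by
  rw [sum_sigma', sum_sigma']
  refine sum_bij' (fun x _ => ⟨(x.2.1.degree, x.2.2.degree), x.2⟩)
    (fun x _ => ⟨x.2.1 + x.2.2, x.2⟩) ?_ ?_ ?_ ?_ fun _ _ => rfl
  all_goals
    simp only [mem_sigma, mem_finsuppAntidiag_univ, HasAntidiagonal.mem_antidiagonal, mem_product]
    grind

theorem homNorm_mul_le (m : ℕ) (F G : MvPowerSeries σ R) :
    homNorm m (F * G) ≤ ∑ p ∈ antidiagonal m, homNorm p.1 F * homNorm p.2 G := by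
  calc homNorm m (F * G)
      ≤ ∑ k ∈ finsuppAntidiag univ m, ∑ a ∈ antidiagonal k, ‖coeff a.1 F‖ * ‖coeff a.2 G‖ :=
        sum_le_sum fun k _ => by
          rw [MvPowerSeries.coeff_mul]
          exact norm_sum_le_of_le _ fun a _ => norm_mul_le _ _
    _ = ∑ p ∈ antidiagonal m, homNorm p.1 F * homNorm p.2 G := by
        simp only [sum_finsuppAntidiag_sum_antidiagonal, homNorm, sum_mul_sum, sum_product]

end Ring

section CommRing

variable [SeminormedCommRing R]

theorem homNorm_pderiv_le (i : σ) (m : ℕ) (F : MvPowerSeries σ R) :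
    homNorm m (pderiv R i F) ≤ ∑ k ∈ finsuppAntidiag univ (m + 1), (k i : ℝ) * ‖coeff k F‖ := by
  let shift : (σ →₀ ℕ) ↪ (σ →₀ ℕ) := addRightEmbedding (Finsupp.single i 1)
  calc homNorm m (pderiv R i F)
      ≤ ∑ k ∈ finsuppAntidiag univ m, ((shift k) i : ℝ) * ‖coeff (shift k) F‖ := by
        refine sum_le_sum fun k _ => ?_
        have h := norm_nsmul_le (n := k i + 1) (a := coeff (k + Finsupp.single i 1) F)
        simpa [MvPowerSeries.coeff_pderiv, shift, nsmul_eq_mul, mul_comm] using h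
    _ = ∑ k ∈ (finsuppAntidiag univ m).map shift, (k i : ℝ) * ‖coeff k F‖ := by rw [sum_map]
    _ ≤ ∑ k ∈ finsuppAntidiag univ (m + 1), (k i : ℝ) * ‖coeff k F‖ := by
        refine sum_le_sum_of_subset_of_nonneg (fun k hk => ?_) fun k _ _ => by positivity
        obtain ⟨l, hl, rfl⟩ := mem_map.1 hk
        rw [mem_finsuppAntidiag_univ] at hl ⊢
        simp [shift, hl]

theorem sum_homNorm_pderiv_le (m : ℕ) (F : MvPowerSeries σ R) :
    ∑ i, homNorm m (pderiv R i F) ≤ (m + 1) * homNorm (m + 1) F := by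
  refine (sum_le_sum fun i _ => homNorm_pderiv_le i m F).trans_eq ?_
  rw [sum_comm, homNorm, mul_sum]
  refine sum_congr rfl fun k hk => ?_
  rw [mem_finsuppAntidiag_univ, Finsupp.degree_eq_sum] at hk
  rw [← sum_mul]
  congr 1
  exact_mod_cast hk

end CommRing

end HomNorm

section Pderiv

variable {σ R : Type*} [CommSemiring R]

theorem order_le_order_pderiv_add_one (i : σ) (F : MvPowerSeries σ R) :
    F.order ≤ (pderiv R i F).order + 1 := by
  rw [← tsub_le_iff_right]
  refine MvPowerSeries.le_order fun k hk => ?_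
  rw [MvPowerSeries.coeff_pderiv, MvPowerSeries.coeff_of_lt_order, zero_mul]
  simpa using lt_tsub_iff_right.1 hk

theorem coeff_pderiv_mul_pderiv_eq_zero {F G : MvPowerSeries σ R} {k : σ →₀ ℕ}
    (hk : (k.degree : ℕ∞) + 2 < F.order + G.order) (i j : σ) :
    coeff k (pderiv R i F * pderiv R j G) = 0 := by
  refine MvPowerSeries.coeff_of_lt_order (lt_of_add_lt_add_right (a := 2) ?_)
  calc (k.degree : ℕ∞) + 2 < F.order + G.order := hk
    _ ≤ ((pderiv R i F).order + 1) + ((pderiv R j G).order + 1) :=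
        add_le_add (order_le_order_pderiv_add_one i F) (order_le_order_pderiv_add_one j G)
    _ = (pderiv R i F).order + (pderiv R j G).order + 2 := by ring
    _ ≤ (pderiv R i F * pderiv R j G).order + 2 := by
        gcongr
        exact MvPowerSeries.le_order_mul

theorem coeff_pderiv_mul_X (i : σ) (F : MvPowerSeries σ R) (k : σ →₀ ℕ) :
    coeff k (pderiv R i F * MvPowerSeries.X i) = k i * coeff k F := by
  classical
  rw [MvPowerSeries.X, MvPowerSeries.coeff_mul_monomial]
  split_ifs with h
  · rw [MvPowerSeries.coeff_pderiv, tsub_add_cancel_of_le h, mul_one, mul_comm, ← Nat.cast_add_one,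
      Finsupp.tsub_apply, Finsupp.single_eq_same, Nat.sub_add_cancel (Finsupp.single_le_iff.1 h)]
  · rw [Finsupp.single_le_iff, Nat.one_le_iff_ne_zero, not_not] at h
    rw [h, Nat.cast_zero, zero_mul]

theorem continuous_pderiv [TopologicalSpace R] [ContinuousMul R] (i : σ) :
    Continuous (pderiv R i : MvPowerSeries σ R → MvPowerSeries σ R) :=
  continuous_pi fun k => by
    change Continuous fun F => coeff k (pderiv R i F)
    simp only [MvPowerSeries.coeff_pderiv]
    exact (MvPowerSeries.WithPiTopology.continuous_coeff R _).mul_const _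

end Pderiv

section PoissonBracket

variable {n : ℕ}

theorem poissonBracket_add_right (F G H : Series n) :
    poissonBracket F (G + H) = poissonBracket F G + poissonBracket F H := by
  simp only [poissonBracket, map_add, ← smul_add, ← sum_add_distrib]
  congr 1
  exact sum_congr rfl fun _ _ => by ring

theorem poissonBracket_sub_poissonBracket (F F' G G' : Series n) :
    poissonBracket F G - poissonBracket F' G' =
      poissonBracket (F - F') G + poissonBracket F' (G - G') := by
  simp only [poissonBracket, map_sub, ← smul_sub, ← smul_add, ← sum_sub_distrib, ← sum_add_distrib]
  congr 1
  exact sum_congr rfl fun _ _ => by ring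

theorem continuous_poissonBracket :
    Continuous fun P : Series n × Series n => poissonBracket P.1 P.2 := by
  have hfst (i : Fin n ⊕ Fin n) : Continuous fun P : Series n × Series n => pderiv ℂ i P.1 :=
    (continuous_pderiv i).comp continuous_fst
  have hsnd (i : Fin n ⊕ Fin n) : Continuous fun P : Series n × Series n => pderiv ℂ i P.2 :=
    (continuous_pderiv i).comp continuous_snd
  exact (continuous_finsetSum _ fun j _ =>
    ((hfst _).mul (hsnd _)).sub ((hfst _).mul (hsnd _))).const_smul Complex.I

theorem coeff_poissonBracket_eq_zero {F G : Series n} {k : Index n}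
    (hk : (k.degree : ℕ∞) + 2 < F.order + G.order) : coeff k (poissonBracket F G) = 0 := by
  simp [poissonBracket, coeff_pderiv_mul_pderiv_eq_zero hk]

theorem norm_coeff_poissonBracket_le (F G : Series n) (k : Index n) :
    ‖coeff k (poissonBracket F G)‖ ≤
      ∑ i : Fin n ⊕ Fin n, ‖coeff k (pderiv ℂ i F * pderiv ℂ i.swap G)‖ := by
  simp only [poissonBracket, map_smul, map_sum, map_sub, norm_smul, Complex.norm_I, one_mul,
    Fintype.sum_sum_type, Sum.swap_inl, Sum.swap_inr]
  rw [add_comm, ← sum_add_distrib]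
  exact norm_sum_le_of_le _ fun j _ => norm_sub_le _ _

theorem homNorm_poissonBracket_le (m : ℕ) (F G : Series n) :
    homNorm m (poissonBracket F G) ≤ ∑ p ∈ antidiagonal m,
      ((p.1 + 1) * homNorm (p.1 + 1) F) * ((p.2 + 1) * homNorm (p.2 + 1) G) := by
  calc homNorm m (poissonBracket F G)
      ≤ ∑ i, homNorm m (pderiv ℂ i F * pderiv ℂ i.swap G) := by
        unfold homNorm
        rw [sum_comm]
        exact sum_le_sum fun k _ => norm_coeff_poissonBracket_le F G k
    _ ≤ ∑ i, ∑ p ∈ antidiagonal m,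
          homNorm p.1 (pderiv ℂ i F) * homNorm p.2 (pderiv ℂ i.swap G) :=
        sum_le_sum fun i _ => homNorm_mul_le m _ _
    _ = ∑ p ∈ antidiagonal m, ∑ i,
          homNorm p.1 (pderiv ℂ i F) * homNorm p.2 (pderiv ℂ i.swap G) := sum_comm
    _ ≤ ∑ p ∈ antidiagonal m,
          (∑ i, homNorm p.1 (pderiv ℂ i F)) * ∑ i, homNorm p.2 (pderiv ℂ i G) := by
        refine sum_le_sum fun p _ => ?_
        rw [sum_mul]
        refine sum_le_sum fun i _ => mul_le_mul_of_nonneg_left ?_ (homNorm_nonneg _ _)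
        exact single_le_sum (f := fun j => homNorm p.2 (pderiv ℂ j G))
          (fun j _ => homNorm_nonneg _ _) (mem_univ i.swap)
    _ ≤ ∑ p ∈ antidiagonal m,
          ((p.1 + 1) * homNorm (p.1 + 1) F) * ((p.2 + 1) * homNorm (p.2 + 1) G) :=
        sum_le_sum fun p _ => mul_le_mul (sum_homNorm_pderiv_le _ _) (sum_homNorm_pderiv_le _ _)
          (sum_nonneg fun _ _ => homNorm_nonneg _ _)
          (mul_nonneg (by positivity) (homNorm_nonneg _ _))

theorem pderiv_inl_quadraticPart (ω : Fin n → ℝ) (j : Fin n) :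
    pderiv ℂ (Sum.inl j) (quadraticPart ω) = (ω j : ℂ) • MvPowerSeries.X (Sum.inr j) := by
  simp [quadraticPart, Derivation.leibniz, MvPowerSeries.pderiv_X, Pi.single_apply,
    -Complex.coe_smul]

theorem pderiv_inr_quadraticPart (ω : Fin n → ℝ) (j : Fin n) :
    pderiv ℂ (Sum.inr j) (quadraticPart ω) = (ω j : ℂ) • MvPowerSeries.X (Sum.inl j) := by
  simp [quadraticPart, Derivation.leibniz, MvPowerSeries.pderiv_X, Pi.single_apply,
    -Complex.coe_smul]

theorem coeff_poissonBracket_quadraticPart (ω : Fin n → ℝ) (F : Series n) (k : Index n) :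
    coeff k (poissonBracket F (quadraticPart ω)) =
      Complex.I * (frequency ω k : ℂ) * coeff k F := by
  simp only [poissonBracket, pderiv_inl_quadraticPart, pderiv_inr_quadraticPart, mul_smul_comm,
    map_smul, map_sum, map_sub, coeff_pderiv_mul_X, smul_eq_mul, frequency]
  push_cast
  rw [mul_assoc, sum_mul]
  congr 1
  exact sum_congr rfl fun _ _ => by ring

end PoissonBracket

section VectorField

variable {n : ℕ} (ω : Fin n → ℝ)

theorem coeff_xi (H : Series n) (k : Index n) :
    coeff k (xi ω H) = -Complex.I * (Real.sign (frequency ω k) : ℂ) * coeff k H := rfl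

theorem xi_sub (G H : Series n) : xi ω (G - H) = xi ω G - xi ω H := by
  ext k
  simp only [coeff_xi, map_sub, mul_sub]

theorem continuous_xi : Continuous (xi ω : Series n → Series n) :=
  continuous_pi fun k => (MvPowerSeries.WithPiTopology.continuous_coeff ℂ k).const_mul _

theorem norm_coeff_xi_le (H : Series n) (k : Index n) : ‖coeff k (xi ω H)‖ ≤ ‖coeff k H‖ := by
  rw [coeff_xi, norm_mul]
  refine mul_le_of_le_one_left (norm_nonneg _) ?_
  rcases Real.sign_apply_eq (frequency ω k) with h | h | h <;> simp [h]

theorem order_le_order_xi (H : Series n) : H.order ≤ (xi ω H).order :=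
  MvPowerSeries.le_order fun k hk => by
    rw [coeff_xi, MvPowerSeries.coeff_of_lt_order hk, mul_zero]

theorem mem_diamondSpace_iff {H : Series n} : H ∈ diamondSpace n ↔ 3 ≤ H.order :=
  ⟨MvPowerSeries.nat_le_order, fun h _ hk =>
    MvPowerSeries.coeff_of_lt_order ((Nat.cast_lt.2 hk).trans_le h)⟩

/-- The nonlinear part `-{ξ H, H}` of the vector field. -/
def nonlinearPart (H : Series n) : Series n :=
  -poissonBracket (xi ω H) H

theorem continuous_nonlinearPart : Continuous (nonlinearPart ω : Series n → Series n) :=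
  (continuous_poissonBracket.comp ((continuous_xi ω).prodMk continuous_id)).neg

theorem sign_mul_self_eq_abs (x : ℝ) : Real.sign x * x = |x| := by
  rcases lt_trichotomy x 0 with hx | rfl | hx
  · rw [Real.sign_of_neg hx, abs_of_neg hx, neg_one_mul]
  · rw [mul_zero, abs_zero]
  · rw [Real.sign_of_pos hx, abs_of_pos hx, one_mul]

theorem coeff_vectorField (H : Series n) (k : Index n) :
    coeff k (-poissonBracket (xi ω H) (quadraticPart ω + H)) =
      -|frequency ω k| • coeff k H + coeff k (nonlinearPart ω H) := by
  have hsign : (frequency ω k : ℂ) * Real.sign (frequency ω k) = (|frequency ω k| : ℝ) := by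
    rw [← Complex.ofReal_mul, mul_comm, sign_mul_self_eq_abs]
  rw [poissonBracket_add_right, neg_add, map_add, nonlinearPart, map_neg,
    coeff_poissonBracket_quadraticPart, coeff_xi, Complex.real_smul, Complex.ofReal_neg, ← hsign]
  linear_combination (frequency ω k * Real.sign (frequency ω k) * coeff k H : ℂ) * Complex.I_mul_I

variable {G H : Series n}

theorem four_le_order_nonlinearPart (hH : H ∈ diamondSpace n) : 4 ≤ (nonlinearPart ω H).order := by
  rw [mem_diamondSpace_iff] at hH
  rw [nonlinearPart, MvPowerSeries.order_neg]
  refine MvPowerSeries.nat_le_order (n := 4) fun k hk => coeff_poissonBracket_eq_zero ?_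
  calc (k.degree : ℕ∞) + 2 < 3 + 3 := by exact_mod_cast (by omega : k.degree + 2 < 3 + 3)
    _ ≤ (xi ω H).order + H.order := add_le_add (hH.trans (order_le_order_xi ω H)) hH

theorem coeff_nonlinearPart_congr (hG : G ∈ diamondSpace n) (hH : H ∈ diamondSpace n)
    {k : Index n} (h : ∀ l : Index n, l.degree < k.degree → coeff l G = coeff l H) :
    coeff k (nonlinearPart ω G) = coeff k (nonlinearPart ω H) := by
  rw [mem_diamondSpace_iff] at hG hH
  have hsub : (k.degree : ℕ∞) ≤ (G - H).order :=
    MvPowerSeries.nat_le_order fun l hl => by rw [map_sub, h l hl, sub_self]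
  have hlt : (k.degree : ℕ∞) + 2 < k.degree + 3 := by exact_mod_cast Nat.lt_succ_self _
  rw [nonlinearPart, nonlinearPart, map_neg, map_neg, neg_inj, ← sub_eq_zero, ← map_sub,
    poissonBracket_sub_poissonBracket, ← xi_sub, map_add,
    coeff_poissonBracket_eq_zero (hlt.trans_le <|
      add_le_add (hsub.trans (order_le_order_xi ω _)) hG),
    coeff_poissonBracket_eq_zero (hlt.trans_le <| (add_comm _ _).trans_le <|
      add_le_add (hH.trans (order_le_order_xi ω _)) hsub), add_zero]

theorem homNorm_nonlinearPart_le (hH : H ∈ diamondSpace n) (e : ℕ) :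
    homNorm (e + 4) (nonlinearPart ω H) ≤ ∑ p ∈ antidiagonal e,
      ((p.1 + 3) * homNorm (p.1 + 3) H) * ((p.2 + 3) * homNorm (p.2 + 3) H) := by
  rw [mem_diamondSpace_iff] at hH
  have hlow {m : ℕ} (hm : m < 3) : homNorm m H = 0 :=
    homNorm_eq_zero_of_lt_order ((Nat.cast_lt.2 hm).trans_le hH)
  calc homNorm (e + 4) (nonlinearPart ω H)
      ≤ homNorm (e + 4) (poissonBracket (xi ω H) H) :=
        homNorm_mono (fun k => by rw [nonlinearPart, map_neg, norm_neg]) _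
    _ ≤ ∑ p ∈ antidiagonal (e + 4),
          ((p.1 + 1) * homNorm (p.1 + 1) (xi ω H)) * ((p.2 + 1) * homNorm (p.2 + 1) H) :=
        homNorm_poissonBracket_le _ _ _
    _ ≤ ∑ p ∈ antidiagonal (e + 4),
          ((p.1 + 1) * homNorm (p.1 + 1) H) * ((p.2 + 1) * homNorm (p.2 + 1) H) :=
        sum_le_sum fun p _ => by
          have := homNorm_nonneg (p.2 + 1) H
          gcongr
          exact homNorm_mono (norm_coeff_xi_le ω H) _
    _ = ∑ p ∈ antidiagonal e,
          ((p.1 + 3) * homNorm (p.1 + 3) H) * ((p.2 + 3) * homNorm (p.2 + 3) H) := by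
        rw [Nat.sum_antidiagonal_succ, Nat.sum_antidiagonal_succ, Nat.sum_antidiagonal_succ',
          Nat.sum_antidiagonal_succ']
        norm_num [hlow, add_assoc]

end VectorField

section Duhamel

variable {E : Type*} [NormedAddCommGroup E] [NormedSpace ℝ E] {c : ℝ} {y₀ : E} {b : ℝ → E}

/-- Duhamel's formula for the solution of `y' = -c y + b`, `y 0 = y₀`. -/
def duhamel (c : ℝ) (y₀ : E) (b : ℝ → E) (t : ℝ) : E :=
  Real.exp (-(c * t)) • (y₀ + ∫ s in (0 : ℝ)..t, Real.exp (c * s) • b s)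

theorem duhamel_zero (c : ℝ) (y₀ : E) (b : ℝ → E) : duhamel c y₀ b 0 = y₀ := by
  simp [duhamel]

theorem hasDerivAt_duhamel [CompleteSpace E] (c : ℝ) (y₀ : E) (hb : Continuous b) (t : ℝ) :
    HasDerivAt (duhamel c y₀ b) (-c • duhamel c y₀ b t + b t) t := by
  have hexp : HasDerivAt (fun s => Real.exp (-(c * s))) (Real.exp (-(c * t)) * -c) t := by
    simpa using ((hasDerivAt_id t).const_mul c).neg.exp
  have hcont : Continuous fun s => Real.exp (c * s) • b s := by fun_prop
  have hint := (hcont.integral_hasStrictDerivAt 0 t).hasDerivAt.const_add y₀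
  refine (hexp.smul hint).congr_deriv ?_
  rw [smul_smul, ← Real.exp_add, neg_add_cancel, Real.exp_zero, one_smul, add_comm, duhamel,
    smul_smul, mul_comm]

theorem continuous_duhamel [CompleteSpace E] (c : ℝ) (y₀ : E) (hb : Continuous b) :
    Continuous (duhamel c y₀ b) :=
  continuous_iff_continuousAt.2 fun t => (hasDerivAt_duhamel c y₀ hb t).continuousAt

theorem norm_duhamel_le (hc : 0 ≤ c) (y₀ : E) (hb : Continuous b) {t : ℝ} (ht : 0 ≤ t) :
    ‖duhamel c y₀ b t‖ ≤ ‖y₀‖ + ∫ s in (0 : ℝ)..t, ‖b s‖ := by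
  have hexp_smul {s : ℝ} (hs : s ≤ 0) (y : E) : ‖Real.exp s • y‖ ≤ ‖y‖ := by
    rw [norm_smul, Real.norm_eq_abs, Real.abs_exp]
    exact mul_le_of_le_one_left (norm_nonneg _) (Real.exp_le_one_iff.2 hs)
  rw [duhamel, smul_add, ← intervalIntegral.integral_smul]
  refine norm_add_le_of_le (hexp_smul (neg_nonpos.2 (mul_nonneg hc ht)) _) ?_
  refine (intervalIntegral.norm_integral_le_integral_norm ht).trans ?_
  refine intervalIntegral.integral_mono_on ht (Continuous.intervalIntegrable (by fun_prop) _ _)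
    (hb.norm.intervalIntegrable _ _) fun s hs => ?_
  rw [smul_smul, ← Real.exp_add]
  exact hexp_smul (by linarith [mul_le_mul_of_nonneg_left hs.2 hc]) _

theorem eqOn_Ici_of_hasDerivWithinAt_neg_smul_add {f g : ℝ → E} {a : ℝ}
    (hf : ∀ t ∈ Set.Ici a, HasDerivWithinAt f (-c • f t + b t) (Set.Ici a) t)
    (hg : ∀ t ∈ Set.Ici a, HasDerivWithinAt g (-c • g t + b t) (Set.Ici a) t)
    (ha : f a = g a) : Set.EqOn f g (Set.Ici a) := fun t ht =>
  ODE_solution_unique (v := fun s y => -c • y + b s) (K := ‖-c‖₊)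
    (fun s => (lipschitzWith_smul (-c)).add (LipschitzWith.const (b s)) |>.weaken (by simp))
    (fun s hs => (hf s hs.1).continuousWithinAt.mono Set.Icc_subset_Ici_self)
    (fun s hs => (hf s hs.1).mono (Set.Ici_subset_Ici.2 hs.1))
    (fun s hs => (hg s hs.1).continuousWithinAt.mono Set.Icc_subset_Ici_self)
    (fun s hs => (hg s hs.1).mono (Set.Ici_subset_Ici.2 hs.1)) ha ⟨ht, le_rfl⟩

end Duhamel

section FixedPoint

theorem exists_fixedPoint_of_wellFounded {ι E : Type*} {r : ι → ι → Prop} (hr : WellFounded r)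
    {S : ι → Set E} (hS : (Set.univ.pi S).Nonempty) {Φ : (ι → E) → ι → E}
    (hΦ : Set.MapsTo Φ (Set.univ.pi S) (Set.univ.pi S))
    (hcausal : ∀ x ∈ Set.univ.pi S, ∀ y ∈ Set.univ.pi S, ∀ k,
      (∀ l, r l k → x l = y l) → Φ x k = Φ y k) :
    ∃ x ∈ Set.univ.pi S, Φ x = x := by
  classical
  obtain ⟨x₀, hx₀⟩ := hS
  let x : ι → E := hr.fix fun k below => Φ (fun l => if h : r l k then below l h else x₀ l) k
  let truncated (k l : ι) : E := if r l k then x l else x₀ l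
  have hx (k : ι) : x k = Φ (truncated k) k := hr.fix_eq _ k
  have htruncated (k : ι) (h : ∀ l, r l k → x l ∈ S l) : truncated k ∈ Set.univ.pi S := by
    intro l _
    by_cases hl : r l k
    · simpa only [truncated, if_pos hl] using h l hl
    · simpa only [truncated, if_neg hl] using hx₀ l trivial
  have hxS (k : ι) : x k ∈ S k := by
    induction k using hr.induction with
    | _ k ih => exact hx k ▸ hΦ (htruncated k ih) k trivial
  refine ⟨x, fun k _ => hxS k, funext fun k => ?_⟩
  rw [hx k]
  exact hcausal _ (fun l _ => hxS l) _ (htruncated k fun l _ => hxS l) k fun l hl =>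
    (if_pos hl).symm

end FixedPoint

section Flow

variable {n : ℕ} {ω : Fin n → ℝ} {Hhat : Series n} {γ γ' : ℝ → Series n}

/-- The integral form of the initial value problem: by Duhamel's formula, a continuous curve of
series of order at least `3`, defined for all times, whose coefficients solve the damped linear
equations driven by its nonlinear part. -/
structure IsMildSolution (ω : Fin n → ℝ) (Hhat : Series n) (γ : ℝ → Series n) : Prop where
  mem_diamondSpace : ∀ δ, γ δ ∈ diamondSpace n
  continuous : Continuous γ
  coeff_eq_duhamel : ∀ δ k, coeff k (γ δ) =
    duhamel |frequency ω k| (coeff k Hhat) (fun s => coeff k (nonlinearPart ω (γ s))) δ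

theorem continuous_coeff_nonlinearPart (ω : Fin n → ℝ) (hγ : Continuous γ) (k : Index n) :
    Continuous fun s => coeff k (nonlinearPart ω (γ s)) :=
  (MvPowerSeries.WithPiTopology.continuous_coeff ℂ k).comp ((continuous_nonlinearPart ω).comp hγ)

theorem exists_isMildSolution (ω : Fin n → ℝ) (hHhat : Hhat ∈ diamondSpace n) :
    ∃ γ, IsMildSolution ω Hhat γ := by
  let curve (x : Index n → ℝ → ℂ) (s : ℝ) : Series n := fun k => x k s
  let S (k : Index n) : Set (ℝ → ℂ) := {f | Continuous f ∧ (k.degree < 3 → f = 0)}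
  have hcont {x : Index n → ℝ → ℂ} (hx : x ∈ Set.univ.pi S) : Continuous (curve x) :=
    continuous_pi fun k => (hx k trivial).1
  have hmem {x : Index n → ℝ → ℂ} (hx : x ∈ Set.univ.pi S) (s : ℝ) :
      curve x s ∈ diamondSpace n := fun k hk => congrFun ((hx k trivial).2 hk) s
  obtain ⟨x, hx, hfix⟩ := exists_fixedPoint_of_wellFounded
    (InvImage.wf (Finsupp.degree : Index n → ℕ) wellFounded_lt) (S := S)
    ⟨0, fun _ _ => ⟨continuous_zero, fun _ => rfl⟩⟩
    (Φ := fun x k => duhamel |frequency ω k| (coeff k Hhat)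
      fun s => coeff k (nonlinearPart ω (curve x s)))
    (fun x hx k _ => ⟨continuous_duhamel _ _ (continuous_coeff_nonlinearPart ω (hcont hx) k),
      fun hk => funext fun δ => by
        have hzero (s : ℝ) : coeff k (nonlinearPart ω (curve x s)) = 0 :=
          MvPowerSeries.coeff_of_lt_order <|
            (Nat.cast_lt.2 (hk.trans (Nat.lt_succ_self 3))).trans_le
              (four_le_order_nonlinearPart ω (hmem hx s))
        simp [duhamel, hzero, hHhat k hk]⟩)
    (fun x hx y hy k hxy => congrArg _ <| funext fun s =>
      coeff_nonlinearPart_congr ω (hmem hx s) (hmem hy s) fun l hl => congrFun (hxy l hl) s)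
  exact ⟨curve x, hmem hx, hcont hx, fun δ k => (congrFun (congrFun hfix k) δ).symm⟩

theorem IsMildSolution.isSolution (h : IsMildSolution ω Hhat γ) (I : Set ℝ) :
    IsSolution ω Hhat I γ where
  mem_diamondSpace δ _ := h.mem_diamondSpace δ
  initial := MvPowerSeries.ext fun k => by rw [h.coeff_eq_duhamel, duhamel_zero]
  hasDeriv δ _ k := by
    rw [coeff_vectorField]
    simp only [h.coeff_eq_duhamel _ k]
    exact (hasDerivAt_duhamel _ _
      (continuous_coeff_nonlinearPart ω h.continuous k) δ).hasDerivWithinAt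

theorem IsSolution.eqOn (h : IsSolution ω Hhat (Set.Ici 0) γ)
    (h' : IsSolution ω Hhat (Set.Ici 0) γ') : Set.EqOn γ γ' (Set.Ici 0) := by
  suffices H : ∀ k : Index n,
      Set.EqOn (fun δ => coeff k (γ δ)) (fun δ => coeff k (γ' δ)) (Set.Ici 0) from
    fun δ hδ => MvPowerSeries.ext fun k => H k hδ
  intro k
  induction k using (InvImage.wf (Finsupp.degree : Index n → ℕ) wellFounded_lt).induction with
  | _ k ih =>
    have hderiv (t : ℝ) (ht : t ∈ Set.Ici 0) := coeff_vectorField ω (γ t) k ▸ h.hasDeriv t ht k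
    have hderiv' (t : ℝ) (ht : t ∈ Set.Ici 0) := coeff_vectorField ω (γ' t) k ▸ h'.hasDeriv t ht k
    refine eqOn_Ici_of_hasDerivWithinAt_neg_smul_add hderiv (fun t ht => ?_)
      (by rw [h.initial, h'.initial])
    rw [coeff_nonlinearPart_congr ω (h.mem_diamondSpace t ht) (h'.mem_diamondSpace t ht)
      fun l hl => ih l hl ht]
    exact hderiv' t ht

theorem IsMildSolution.flowDefined (h : IsMildSolution ω Hhat γ) : FlowDefined ω Hhat :=
  ⟨γ, h.isSolution _, fun _ h' => h'.eqOn (h.isSolution _)⟩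

theorem IsMildSolution.flow_eq (h : IsMildSolution ω Hhat γ) {δ : ℝ} (hδ : 0 ≤ δ) :
    flow ω δ Hhat = γ δ := by
  rw [flow, dif_pos h.flowDefined]
  exact h.flowDefined.choose_spec.1.eqOn (h.isSolution _) hδ

theorem IsMildSolution.homNorm_le_add_integral (h : IsMildSolution ω Hhat γ) (m : ℕ) {δ : ℝ}
    (hδ : 0 ≤ δ) : homNorm m (γ δ) ≤
      homNorm m Hhat + ∫ s in (0 : ℝ)..δ, homNorm m (nonlinearPart ω (γ s)) := by
  have hcont := continuous_coeff_nonlinearPart ω h.continuous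
  unfold homNorm
  rw [intervalIntegral.integral_finsetSum fun k _ => (hcont k).norm.intervalIntegrable _ _,
    ← sum_add_distrib]
  refine sum_le_sum fun k _ => ?_
  rw [h.coeff_eq_duhamel]
  exact norm_duhamel_le (abs_nonneg _) _ (hcont k) hδ

end Flow

section Majorant

variable {C R u : ℝ}

/-- The bound propagated by the flow for the homogeneous component of degree `d + 3`, as a function
of `u = 1 + 16 C R² δ`. The exponent of `d + 3` is the least integer for which the majorant is a
supersolution of the quadratic system: there the convolution of `1 / (d + 3) ^ 2` with itself must
be of the size of `1 / (d + 3) ^ 2`, which fails for `1 / (d + 3)`. -/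
def majorant (C R : ℝ) (d : ℕ) (u : ℝ) : ℝ :=
  C * R ^ (d + 3) / (d + 3) ^ 3 * u ^ d

theorem majorant_nonneg (hC : 0 ≤ C) (hR : 0 ≤ R) (hu : 0 ≤ u) (d : ℕ) : 0 ≤ majorant C R d u := by
  unfold majorant
  positivity

theorem differentiable_majorant (C R : ℝ) (d : ℕ) : Differentiable ℝ (majorant C R d) :=
  (differentiable_id.pow d).const_mul _

theorem deriv_majorant (C R : ℝ) (d : ℕ) (u : ℝ) :
    deriv (majorant C R d) u = C * R ^ (d + 3) / (d + 3) ^ 3 * (d * u ^ (d - 1)) := by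
  unfold majorant
  simp

theorem majorant_le_geometric (hC : 0 ≤ C) (hR : 0 ≤ R) (hu : 1 ≤ u) (d : ℕ) :
    majorant C R d u ≤ C * (R * u) ^ (d + 3) := by
  rw [majorant, mul_pow, ← mul_assoc]
  have hd : (1 : ℝ) ≤ (d + 3) ^ 3 := one_le_pow₀ (by linarith [d.cast_nonneg (α := ℝ)])
  exact mul_le_mul (div_le_self (by positivity) hd) (pow_le_pow_right₀ hu (by omega))
    (by positivity) (by positivity)

theorem sum_antidiagonal_inv_add_three_sq_le (e : ℕ) :
    ∑ p ∈ antidiagonal e, (((p.1 : ℝ) + 3) ^ 2)⁻¹ ≤ 1 := by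
  calc ∑ p ∈ antidiagonal e, (((p.1 : ℝ) + 3) ^ 2)⁻¹
      = ∑ i ∈ Ioo 2 (e + 4), ((i : ℝ) ^ 2)⁻¹ := by
        refine sum_nbij' (fun p => p.1 + 3) (fun i => (i - 3, e + 3 - i)) ?_ ?_ ?_ ?_ ?_
        all_goals
          simp only [HasAntidiagonal.mem_antidiagonal, mem_Ioo]
          grind
    _ ≤ 2 / ((2 : ℕ) + 1) := sum_Ioo_inv_sq_le 2 (e + 4)
    _ ≤ 1 := by norm_num

theorem inv_sq_mul_inv_sq_le {x y : ℝ} (hx : 0 < x) (hy : 0 < y) :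
    (x ^ 2)⁻¹ * (y ^ 2)⁻¹ ≤ 2 / (x + y) ^ 2 * ((x ^ 2)⁻¹ + (y ^ 2)⁻¹) := by
  have h : (x ^ 2)⁻¹ + (y ^ 2)⁻¹ = (x ^ 2 + y ^ 2) * ((x ^ 2)⁻¹ * (y ^ 2)⁻¹) := by
    field_simp
    ring
  rw [h, ← mul_assoc]
  refine le_mul_of_one_le_left (by positivity) ?_
  rw [div_mul_eq_mul_div, one_le_div (by positivity)]
  exact add_sq_le

theorem sum_antidiagonal_inv_sq_mul_inv_sq_le (e : ℕ) :
    ∑ p ∈ antidiagonal e, (((p.1 : ℝ) + 3) ^ 2)⁻¹ * (((p.2 : ℝ) + 3) ^ 2)⁻¹ ≤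
      16 * ((e : ℝ) + 1) / ((e : ℝ) + 4) ^ 3 := by
  have hswap : ∑ p ∈ antidiagonal e, (((p.2 : ℝ) + 3) ^ 2)⁻¹ ≤ 1 := by
    rw [← Nat.sum_antidiagonal_swap]
    exact sum_antidiagonal_inv_add_three_sq_le e
  calc ∑ p ∈ antidiagonal e, (((p.1 : ℝ) + 3) ^ 2)⁻¹ * (((p.2 : ℝ) + 3) ^ 2)⁻¹
      ≤ ∑ p ∈ antidiagonal e, 2 / ((e : ℝ) + 6) ^ 2 *
          ((((p.1 : ℝ) + 3) ^ 2)⁻¹ + (((p.2 : ℝ) + 3) ^ 2)⁻¹) := by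
        refine sum_le_sum fun p hp => ?_
        have he : (e : ℝ) + 6 = (p.1 + 3) + (p.2 + 3) := by
          rw [← HasAntidiagonal.mem_antidiagonal.1 hp]
          push_cast
          ring
        rw [he]
        exact inv_sq_mul_inv_sq_le (by positivity) (by positivity)
    _ = 2 / ((e : ℝ) + 6) ^ 2 * (∑ p ∈ antidiagonal e, (((p.1 : ℝ) + 3) ^ 2)⁻¹ +
          ∑ p ∈ antidiagonal e, (((p.2 : ℝ) + 3) ^ 2)⁻¹) := by
        rw [← mul_sum, sum_add_distrib]
    _ ≤ 2 / ((e : ℝ) + 6) ^ 2 * (1 + 1) := by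
        gcongr
        exact sum_antidiagonal_inv_add_three_sq_le e
    _ ≤ 16 * (e + 1) / (e + 4) ^ 3 := by
        rw [div_mul_eq_mul_div, div_le_div_iff₀ (by positivity) (by positivity)]
        nlinarith [e.cast_nonneg (α := ℝ)]

theorem sum_antidiagonal_majorant_le (C : ℝ) (hR : 0 ≤ R) (hu : 0 ≤ u) (e : ℕ) :
    ∑ p ∈ antidiagonal e, ((p.1 + 3) * majorant C R p.1 u) * ((p.2 + 3) * majorant C R p.2 u) ≤
      16 * C * R ^ 2 * deriv (majorant C R (e + 1)) u := by
  have hterm (d : ℕ) :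
      (d + 3) * majorant C R d u = C * R ^ (d + 3) * u ^ d * (((d : ℝ) + 3) ^ 2)⁻¹ := by
    unfold majorant
    field_simp
  calc ∑ p ∈ antidiagonal e, ((p.1 + 3) * majorant C R p.1 u) * ((p.2 + 3) * majorant C R p.2 u)
      = C ^ 2 * R ^ (e + 6) * u ^ e *
          ∑ p ∈ antidiagonal e, (((p.1 : ℝ) + 3) ^ 2)⁻¹ * (((p.2 : ℝ) + 3) ^ 2)⁻¹ := by
        rw [mul_sum]
        refine sum_congr rfl fun p hp => ?_
        rw [hterm, hterm, ← HasAntidiagonal.mem_antidiagonal.1 hp]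
        ring
    _ ≤ C ^ 2 * R ^ (e + 6) * u ^ e * (16 * (e + 1) / (e + 4) ^ 3) := by
        gcongr
        exact sum_antidiagonal_inv_sq_mul_inv_sq_le e
    _ = 16 * C * R ^ 2 * deriv (majorant C R (e + 1)) u := by
        rw [deriv_majorant, Nat.add_sub_cancel]
        push_cast
        ring

theorem homNorm_nonlinearPart_le_deriv_majorant {n : ℕ} (ω : Fin n → ℝ) {H : Series n}
    (hH : H ∈ diamondSpace n) (hC : 0 ≤ C) (hR : 0 ≤ R) (hu : 0 ≤ u) {d : ℕ}
    (h : ∀ e < d, homNorm (e + 3) H ≤ majorant C R e u) :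
    homNorm (d + 3) (nonlinearPart ω H) ≤ 16 * C * R ^ 2 * deriv (majorant C R d) u := by
  cases d with
  | zero =>
    have hzero : homNorm (0 + 3) (nonlinearPart ω H) = 0 := homNorm_eq_zero_of_lt_order <|
      (Nat.cast_lt.2 (Nat.lt_succ_self 3)).trans_le (four_le_order_nonlinearPart ω hH)
    simp [hzero, deriv_majorant]
  | succ e =>
    refine (homNorm_nonlinearPart_le ω hH e).trans <|
      (sum_le_sum fun p hp => ?_).trans (sum_antidiagonal_majorant_le C hR hu e)
    have hp := HasAntidiagonal.mem_antidiagonal.1 hp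
    have := homNorm_nonneg (p.2 + 3) H
    have := majorant_nonneg hC hR hu p.1
    gcongr
    · exact h _ (by omega)
    · exact h _ (by omega)

theorem integral_deriv_majorant (C R B : ℝ) (d : ℕ) (δ : ℝ) :
    ∫ s in (0 : ℝ)..δ, B * deriv (majorant C R d) (1 + B * s) =
      majorant C R d (1 + B * δ) - majorant C R d 1 := by
  have hderiv (s : ℝ) : HasDerivAt (fun s => majorant C R d (1 + B * s))
      (B * deriv (majorant C R d) (1 + B * s)) s := by
    have haffine : HasDerivAt (fun s => 1 + B * s) B s := by
      simpa using ((hasDerivAt_id s).const_mul B).const_add 1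
    rw [mul_comm]
    exact (differentiable_majorant C R d _).hasDerivAt.comp s haffine
  rw [intervalIntegral.integral_eq_sub_of_hasDerivAt (fun s _ => hderiv s), mul_zero, add_zero]
  refine Continuous.intervalIntegrable ?_ _ _
  simp only [deriv_majorant]
  fun_prop

theorem IsMildSolution.homNorm_le_majorant {n : ℕ} {ω : Fin n → ℝ} {Hhat : Series n}
    {γ : ℝ → Series n} (h : IsMildSolution ω Hhat γ) (hC : 0 ≤ C) (hR : 0 ≤ R)
    (h₀ : ∀ d, homNorm (d + 3) Hhat ≤ majorant C R d 1) (d : ℕ) {δ : ℝ} (hδ : 0 ≤ δ) :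
    homNorm (d + 3) (γ δ) ≤ majorant C R d (1 + 16 * C * R ^ 2 * δ) := by
  induction d using Nat.strong_induction_on generalizing δ with
  | _ d ih =>
    calc homNorm (d + 3) (γ δ)
        ≤ homNorm (d + 3) Hhat + ∫ s in (0 : ℝ)..δ, homNorm (d + 3) (nonlinearPart ω (γ s)) :=
          h.homNorm_le_add_integral _ hδ
      _ ≤ majorant C R d 1 + ∫ s in (0 : ℝ)..δ,
            16 * C * R ^ 2 * deriv (majorant C R d) (1 + 16 * C * R ^ 2 * s) := by
          refine add_le_add (h₀ d) (intervalIntegral.integral_mono_on hδ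
            (Continuous.intervalIntegrable ?_ _ _) (Continuous.intervalIntegrable ?_ _ _)
            fun s hs => ?_)
          · exact (continuous_homNorm _).comp ((continuous_nonlinearPart ω).comp h.continuous)
          · simp only [deriv_majorant]
            fun_prop
          · have hs₀ : 0 ≤ s := hs.1
            exact homNorm_nonlinearPart_le_deriv_majorant ω (h.mem_diamondSpace s) hC hR
              (by positivity) fun e he => ih e he hs₀
      _ = majorant C R d (1 + 16 * C * R ^ 2 * δ) := by
          rw [integral_deriv_majorant, add_sub_cancel]

theorem IsMildSolution.homNorm_le_geometric {n : ℕ} {ω : Fin n → ℝ} {Hhat : Series n}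
    {γ : ℝ → Series n} (h : IsMildSolution ω Hhat γ) (hC : 0 ≤ C) (hR : 0 ≤ R)
    (h₀ : ∀ d, homNorm (d + 3) Hhat ≤ majorant C R d 1) {δ : ℝ} (hδ : 0 ≤ δ) (m : ℕ) :
    homNorm m (γ δ) ≤ C * (R * (1 + 16 * C * R ^ 2 * δ)) ^ m := by
  by_cases hm : m < 3
  · rw [homNorm_eq_zero_of_lt_order
      ((Nat.cast_lt.2 hm).trans_le (mem_diamondSpace_iff.1 (h.mem_diamondSpace δ)))]
    positivity
  · obtain ⟨d, rfl⟩ := Nat.exists_eq_add_of_le' (not_lt.1 hm)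
    exact (h.homNorm_le_majorant hC hR h₀ d hδ).trans <|
      majorant_le_geometric hC hR (le_add_of_nonneg_right (by positivity)) d

end Majorant

section AnalyticSpace

variable {n : ℕ} {H : Series n} {r ρ : ℝ}

theorem norm_term_le {z : Fin n ⊕ Fin n → ℂ} (hz : ∀ i, ‖z i‖ ≤ r) (H : Series n) (k : Index n) :
    ‖term H z k‖ ≤ ‖coeff k H‖ * r ^ k.degree := by
  rw [term, norm_mul, norm_prod, Finsupp.degree_eq_sum, ← prod_pow_eq_pow_sum]
  gcongr with i
  rw [norm_pow]
  exact pow_le_pow_left₀ (norm_nonneg _) (hz i) _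

theorem norm_term_const (hr : 0 ≤ r) (H : Series n) (k : Index n) :
    ‖term H (fun _ => (r : ℂ)) k‖ = ‖coeff k H‖ * r ^ k.degree := by
  simp [term, Finsupp.degree_eq_sum, prod_pow_eq_pow_sum, abs_of_nonneg hr]

theorem mem_analyticSpace_of_summable_homNorm (hr : 0 ≤ r)
    (h : Summable fun m => homNorm m H * r ^ m) : H ∈ analyticSpace n r := by
  have hsum := summable_norm_coeff_mul_pow hr h
  have hterm {z} (hz : z ∈ polydisk n r) := norm_term_le (fun i => (hz i).le) H
  exact ⟨fun z hz => .of_norm_bounded hsum (hterm hz),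
    _, fun z hz => tsum_of_norm_bounded hsum.hasSum (hterm hz)⟩

theorem exists_homNorm_mul_pow_le (hH : H ∈ analyticSpace n ρ) (hr : 0 ≤ r) (hrρ : r < ρ) :
    ∃ C, ∀ m, homNorm m H * r ^ m ≤ C := by
  have hsum := (hH.1 (fun _ => (r : ℂ)) fun _ => by simpa [abs_of_nonneg hr] using hrρ).norm
  simp only [norm_term_const hr] at hsum
  refine ⟨∑' k, ‖coeff k H‖ * r ^ k.degree, fun m => ?_⟩
  rw [homNorm_mul_pow]
  exact hsum.sum_le_tsum _ fun _ _ => by positivity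

theorem exists_homNorm_le_majorant (hρ : 0 < ρ) (hH : H ∈ analyticSpace n ρ) :
    ∃ C R : ℝ, 0 < C ∧ 0 < R ∧ ∀ d : ℕ, homNorm (d + 3) H ≤ majorant C R d 1 := by
  obtain ⟨C, hC⟩ := exists_homNorm_mul_pow_le hH (half_pos hρ).le (half_lt_self hρ)
  refine ⟨max C 1, 8 * (ρ / 2)⁻¹, by positivity, by positivity, fun d => ?_⟩
  have hcube : ((d : ℝ) + 3) ^ 3 ≤ 8 ^ (d + 3) := by
    calc ((d : ℝ) + 3) ^ 3 ≤ (2 ^ (d + 3)) ^ 3 := by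
          gcongr
          exact_mod_cast Nat.lt_two_pow_self.le
      _ = 8 ^ (d + 3) := by rw [pow_right_comm]; norm_num
  calc homNorm (d + 3) H ≤ max C 1 * (ρ / 2)⁻¹ ^ (d + 3) := by
        rw [inv_pow, ← div_eq_mul_inv, le_div_iff₀ (by positivity)]
        exact (hC _).trans (le_max_left _ _)
    _ ≤ max C 1 * (ρ / 2)⁻¹ ^ (d + 3) * (8 ^ (d + 3) / (d + 3) ^ 3) :=
        le_mul_of_one_le_right (by positivity) ((one_le_div (by positivity)).2 hcube)
    _ = majorant (max C 1) (8 * (ρ / 2)⁻¹) d 1 := by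
        rw [majorant, mul_pow]
        ring

theorem mem_analyticSpace_of_homNorm_le_geometric {C Q : ℝ} (hQ : 0 < Q)
    (h : ∀ m, homNorm m H ≤ C * Q ^ m) : H ∈ analyticSpace n (1 / (2 * Q)) := by
  refine mem_analyticSpace_of_summable_homNorm (by positivity) ?_
  refine (summable_geometric_two.mul_left C).of_nonneg_of_le
    (fun m => mul_nonneg (homNorm_nonneg m H) (by positivity)) fun m => ?_
  calc homNorm m H * (1 / (2 * Q)) ^ m ≤ C * Q ^ m * (1 / (2 * Q)) ^ m := by
        gcongr
        exact h m
    _ = C * (1 / 2) ^ m := by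
        rw [mul_assoc, ← mul_pow]
        congr 2
        field_simp

end AnalyticSpace

end NormalizationFlow

end

open NormalizationFlow in
theorem mainTheorem2_general {n : ℕ} (ω : Fin n → ℝ) {ρ : ℝ} (hρ : 0 < ρ) {Hhat : Series n}
    (hHhat : Hhat ∈ analyticSpace n ρ ∩ diamondSpace n) :
    FlowDefined ω Hhat ∧ ∃ A B : ℝ, 0 < A ∧ 0 < B ∧ ∀ δ : ℝ, 0 ≤ δ →
      flow ω δ Hhat ∈ analyticSpace n (A / (1 + B * δ)) ∩ diamondSpace n := by
  obtain ⟨γ, hγ⟩ := exists_isMildSolution ω hHhat.2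
  obtain ⟨C, R, hC, hR, h₀⟩ := exists_homNorm_le_majorant hρ hHhat.1
  refine ⟨hγ.flowDefined, 1 / (2 * R), 16 * C * R ^ 2, by positivity, by positivity,
    fun δ hδ => ?_⟩
  rw [hγ.flow_eq hδ, div_div, mul_assoc 2]
  exact ⟨mem_analyticSpace_of_homNorm_le_geometric (by positivity)
    (hγ.homNorm_le_geometric hC.le hR.le h₀ hδ), hγ.mem_diamondSpace δ⟩

open NormalizationFlow in
theorem mainTheorem2 (n : ℕ) (ω : Fin n → ℝ) (hω : Nonresonant ω)
    (ρ : ℝ) (hρ : 0 < ρ) (Hhat : Series n)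
    (hHhat : Hhat ∈ analyticSpace n ρ ∩ diamondSpace n) :
    FlowDefined ω Hhat ∧
      ∃ A B : ℝ, 0 < A ∧ 0 < B ∧
        ∃ g : ℝ → ℝ, ∀ δ : ℝ, 0 ≤ δ →
          A / (1 + B * δ) ≤ g δ ∧
            flow ω δ Hhat ∈ analyticSpace n (g δ) ∩ diamondSpace n := by
  obtain ⟨hdef, A, B, hA, hB, hflow⟩ := mainTheorem2_general ω hρ hHhat
  exact ⟨hdef, A, B, hA, hB, fun δ => A / (1 + B * δ), fun δ hδ => ⟨le_rfl, hflow δ hδ⟩⟩
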